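/- For an integrable random variable $X$ with i.i.d. copies $X_1,X_2,\dots$, its expected maxima sequence (EMS) is $\mu_k(X)=\mathbb E\max\{X_1,\dots,X_k\}$, $k\ge 1$. Let $\mathcal G$ be the class of functions $g:[1,\infty)\to\mathbb R$ for which there are a finite positive measure $\mu$ on $(0,\infty)$ and measurable real-valued functions $h\ge 0$ and $s$ on $(0,\infty)$ with $$\int_{(0,\infty)} h(y)e^{-y}(1-e^{-y})\,d\mu(y)<\infty,\qquad g(x)=\int_{(0,\infty)} h(y)\big(s(y)-e^{-xy}\big)\,d\mu(y)\quad(x\ge 1),$$ the second integral converging absolutely for every $x\ge1$. Let $\mathcal G^*$ be the set of nonconstant functions in $\mathcal G$. If such a representation of $g$ holds with $h=h_0$, $h_0(y)=\dfrac{e^{y}}{1-e^{-y}}$, we write $g=G_s(\mu)$ and call $\mu$ a canonical measure of $g$. **Theorem.** Every $g\in\mathcal G^*$ has exactly one canonical measure. A real sequence $\{\mu_k\}_{k\ge1}$ is the EMS of a non-degenerate integrable random variable that is symmetric about its mean if and only if there is a function $g\in\mathcal G^*$ with $g(k)=\mu_k$ for all integers $k\ge1$ whose canonical measure $\mu$ satisfies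 $$\mu\big((0,y]\big)=\mu\big([-\log(1-e^{-y}),\infty)\big)\qquad\text{for all } y>0.$$ For any real sequence $\{\mu_k\}_{k\ge1}$ there is at most one $g\in\mathcal G^*$ with $g(k)=\mu_k$ for all $k\ge1$. If $\{\mu_k\}$ is the EMS of such a random variable $X$, with distribution function $F$, then $\lambda:=\mu_2-\mu_1>0$, the function $f_V(x)=\frac1\lambda F(x)(1-F(x))$ is a probability density on $\mathbb R$, and the unique extension $g\in\mathcal G^*$ is $$g(x)=\int_{(0,\infty)}\frac{\lambda e^{y}}{1-e^{-y}}\Big(\frac{\mu_1}{\lambda}e^{-y}(1-e^{-y})+e^{-y}-e^{-xy}\Big)\,dF_Y(y),\qquad x\ge1,$$ where $F_Y$ is the distribution function of $Y=-\log F(V)$ and $V$ has density $f_V$; moreover $Y>0$ almost surely, and the integral converges absolutely. -/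

import Mathlib

namespace EMS

open MeasureTheory ProbabilityTheory Set

noncomputable section

/-- The expected maximum of `k` independent copies of the random variable `X`: the copies are
the variables `ω ↦ X (ω i)`, for `i : Fin k`, on the `k`-fold product probability space.
(Only used for `1 ≤ k`, where the supremum is a maximum.) -/
def expectedMax {Ω : Type*} [MeasurableSpace Ω] (P : Measure Ω) (X : Ω → ℝ) (k : ℕ) : ℝ :=
  ∫ ω : Fin k → Ω, (⨆ i : Fin k, X (ω i)) ∂(Measure.pi fun _ : Fin k => P)

/-- The sequence `m 1, m 2, …` is the expected maxima sequence of `X`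
(the value `m 0` plays no role). -/
def IsEMSOf {Ω : Type*} [MeasurableSpace Ω] (P : Measure Ω) (X : Ω → ℝ) (m : ℕ → ℝ) : Prop :=
  ∀ k : ℕ, 1 ≤ k → m k = expectedMax P X k

/-- `X` is a non-degenerate integrable random variable, symmetric about its mean. -/
structure IsSymmetricNondegenerate {Ω : Type*} [MeasurableSpace Ω] (P : Measure Ω)
    (X : Ω → ℝ) : Prop where
  measurable : Measurable X
  integrable : Integrable X P
  nondegenerate : ¬ ∃ c : ℝ, ∀ᵐ ω ∂P, X ω = c
  symmetric : IdentDistrib (fun ω => X ω - ∫ ω', X ω' ∂P) (fun ω => (∫ ω', X ω' ∂P) - X ω) P P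

/-- `g = G_s(h; μ)`. A measure on `(0, ∞)` is a measure on `ℝ` that gives mass zero to
`(-∞, 0]`. The integral that represents `g` is required to converge absolutely. -/
structure HasGIF (g : Ici (1 : ℝ) → ℝ) (s h : ℝ → ℝ) (μ : Measure ℝ) : Prop where
  finite : IsFiniteMeasure μ
  concentrated : μ (Iic 0) = 0
  measurable_s : Measurable s
  measurable_h : Measurable h
  nonneg_h : ∀ y : ℝ, 0 < y → 0 ≤ h y
  integrable_h : IntegrableOn (fun y => h y * Real.exp (-y) * (1 - Real.exp (-y))) (Ioi 0) μ
  integrable_repr : ∀ x : Ici (1 : ℝ),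
    IntegrableOn (fun y => h y * (s y - Real.exp (-(x * y)))) (Ioi 0) μ
  repr : ∀ x : Ici (1 : ℝ), g x = ∫ y in Ioi 0, h y * (s y - Real.exp (-(x * y))) ∂μ

/-- The class `𝒢` of functions on `[1, ∞)` that admit a generalized integral form. -/
def classG : Set (Ici (1 : ℝ) → ℝ) :=
  {g | ∃ (s h : ℝ → ℝ) (μ : Measure ℝ), HasGIF g s h μ}

/-- The class `𝒢*` of the nonconstant functions in `𝒢`. -/
def classGStar : Set (Ici (1 : ℝ) → ℝ) :=
  {g | g ∈ classG ∧ ¬ ∃ c : ℝ, ∀ x, g x = c}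

/-- The function `h₀(y) = e^y / (1 - e^{-y})`, for `y > 0`. -/
def h₀ (y : ℝ) : ℝ := Real.exp y / (1 - Real.exp (-y))

/-- `g = G_s(μ) = G_s(h₀; μ)` for some `s`: `μ` is the measure in a canonical form of `g`. -/
def IsCanonicalMeasure (g : Ici (1 : ℝ) → ℝ) (μ : Measure ℝ) : Prop :=
  ∃ s : ℝ → ℝ, HasGIF g s h₀ μ

/-- `g` extends the sequence `m 1, m 2, …`. -/
def Extends (g : Ici (1 : ℝ) → ℝ) (m : ℕ → ℝ) : Prop :=
  ∀ (k : ℕ) (hk : 1 ≤ k), g ⟨(k : ℝ), Set.mem_Ici.mpr (Nat.one_le_cast.mpr hk)⟩ = m k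

/-- `μ((0, y]) = μ([-log(1 - e^{-y}), ∞))` for all `y > 0`. -/
def IsReflectionInvariant (μ : Measure ℝ) : Prop :=
  ∀ y : ℝ, 0 < y → μ (Ioc 0 y) = μ (Ici (-Real.log (1 - Real.exp (-y))))

/-- The law of `V`: it has the density `F (1 - F) / l`, where `F` is the distribution
function of `X`. -/
def lawV {Ω : Type*} [MeasurableSpace Ω] (P : Measure Ω) (X : Ω → ℝ) (l : ℝ) : Measure ℝ :=
  volume.withDensity fun x =>
    ENNReal.ofReal (1 / l * (cdf (P.map X) x * (1 - cdf (P.map X) x)))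

/-- The law of `Y = -log F(V)`. -/
def lawY {Ω : Type*} [MeasurableSpace Ω] (P : Measure Ω) (X : Ω → ℝ) (l : ℝ) : Measure ℝ :=
  (lawV P X l).map fun v => -Real.log (cdf (P.map X) v)

end

end EMS

namespace EMS

open MeasureTheory ProbabilityTheory Set

/-! ### The kernel of a canonical form and its bounds. -/

section Kernel

/-! Put `t = e^{-y}`, so that `h₀ = 1 / (t (1 - t))`. Subtracting the value at `1` eliminates `s`,
and a canonical form reads `g x = g 1 + ∫ kernel x dμ`. The increments of `kernel` at consecutive
integers are the powers of `t`, so the increments of `m` are the moments of the image of `μ` on `[0,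
1]`. They determine `μ` (`ext_of_exp_moments`), hence `g`; this gives both uniqueness claims.

For a random variable with distribution function `F`, `E max_k - E max_1 = ∫ (F - F^k) dx`. Since `F
- F^k = F (1 - F) * kernel k (-log F)`, this is an integral of `kernel k` against `λ` times the law
of `Y` (`integral_kernel_lawY`), which is thus the canonical measure. Symmetry replaces `F` by `1 -
F`, that is `t` by `1 - t`, which is the reflection condition.

Conversely, `μ` defines a monotone quantile function `quant`. Applied to independent uniform
variables it commutes with maxima, and Fubini returns `m 1 + ∫ kernel k dμ` (`expectedMax_quant`).
Reflection invariance makes `quant` antisymmetric about `u = 1/2` almost everywhere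
(`quant_one_sub`). -/

lemma exp_neg_lt_one {y : ℝ} (hy : 0 < y) : Real.exp (-y) < 1 :=
  Real.exp_lt_one_iff.2 (by linarith)

lemma one_sub_exp_neg_pos {y : ℝ} (hy : 0 < y) : 0 < 1 - Real.exp (-y) :=
  sub_pos.2 (exp_neg_lt_one hy)

lemma h₀_eq (y : ℝ) : h₀ y = 1 / (Real.exp (-y) * (1 - Real.exp (-y))) := by
  rw [h₀, Real.exp_neg, one_div, mul_inv, inv_inv, div_eq_mul_inv]

lemma h₀_pos {y : ℝ} (hy : 0 < y) : 0 < h₀ y :=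
  div_pos (Real.exp_pos _) (one_sub_exp_neg_pos hy)

lemma measurable_h₀ : Measurable h₀ := by
  unfold h₀
  fun_prop

lemma h₀_mul {y : ℝ} (hy : 0 < y) : h₀ y * Real.exp (-y) * (1 - Real.exp (-y)) = 1 := by
  have h1 := one_sub_exp_neg_pos hy
  have h2 := Real.exp_pos (-y)
  rw [h₀_eq]
  field_simp

/-- The part of a canonical form that depends on `x`. -/
noncomputable def kernel (x y : ℝ) : ℝ := h₀ y * (Real.exp (-y) - Real.exp (-(x * y)))

lemma measurable_kernel (x : ℝ) : Measurable (kernel x) := by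
  unfold kernel
  have := measurable_h₀
  fun_prop

lemma kernel_one (y : ℝ) : kernel 1 y = 0 := by simp [kernel]

lemma kernel_two {y : ℝ} (hy : 0 < y) : kernel 2 y = 1 := by
  have : Real.exp (-(2 * y)) = Real.exp (-y) * Real.exp (-y) := by
    rw [← Real.exp_add]; ring_nf
  rw [kernel, this, ← h₀_mul hy]
  ring

lemma kernel_succ_sub {y : ℝ} (hy : 0 < y) (k : ℕ) :
    kernel ((k : ℝ) + 2) y - kernel ((k : ℝ) + 1) y = Real.exp (-y) ^ k := by
  have e1 : Real.exp (-(((k : ℝ) + 1) * y)) = Real.exp (-y) ^ k * Real.exp (-y) := by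
    rw [← Real.exp_nat_mul, ← Real.exp_add]; ring_nf
  have e2 : Real.exp (-(((k : ℝ) + 2) * y))
      = Real.exp (-y) ^ k * Real.exp (-y) * Real.exp (-y) := by
    rw [← Real.exp_nat_mul, ← Real.exp_add, ← Real.exp_add]; ring_nf
  have := h₀_mul hy
  rw [kernel, kernel, e1, e2]
  linear_combination Real.exp (-y) ^ k * this

lemma kernel_nonneg {x y : ℝ} (hx : 1 ≤ x) (hy : 0 < y) : 0 ≤ kernel x y := by
  refine mul_nonneg (h₀_pos hy).le (sub_nonneg.2 (Real.exp_le_exp.2 ?_))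
  nlinarith

/-- With `n = ⌈x⌉`, Bernoulli's inequality gives `t - t^x ≤ t (1 - t^n) ≤ n t (1 - t)` for `t =
e^{-y}`. The bound is uniform in `y`, so finiteness of `μ` suffices for integrability. -/
lemma kernel_le {x y : ℝ} (hy : 0 < y) : kernel x y ≤ ⌈x⌉₊ := by
  have h1 := one_sub_exp_neg_pos hy
  have hb : 1 + (⌈x⌉₊ : ℝ) * (Real.exp (-y) - 1) ≤ Real.exp (-y) ^ ⌈x⌉₊ := by
    have := one_add_mul_le_pow (a := Real.exp (-y) - 1)
      (by linarith [Real.exp_pos (-y)]) ⌈x⌉₊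
    simpa using this
  have hc : Real.exp (-y) * Real.exp (-y) ^ ⌈x⌉₊ ≤ Real.exp (-(x * y)) := by
    rw [← Real.exp_nat_mul, ← Real.exp_add]
    apply Real.exp_le_exp.2
    have := Nat.le_ceil x
    nlinarith
  have : Real.exp (-y) - Real.exp (-(x * y))
      ≤ ⌈x⌉₊ * (Real.exp (-y) * (1 - Real.exp (-y))) := by
    nlinarith [Real.exp_pos (-y), mul_le_mul_of_nonneg_left hb (Real.exp_pos (-y)).le]
  calc kernel x y ≤ h₀ y * (⌈x⌉₊ * (Real.exp (-y) * (1 - Real.exp (-y)))) :=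
        mul_le_mul_of_nonneg_left this (h₀_pos hy).le
    _ = ⌈x⌉₊ * (h₀ y * Real.exp (-y) * (1 - Real.exp (-y))) := by ring
    _ = ⌈x⌉₊ := by rw [h₀_mul hy, mul_one]

lemma integrableOn_kernel (μ : Measure ℝ) [IsFiniteMeasure μ] {x : ℝ} (hx : 1 ≤ x) :
    IntegrableOn (kernel x) (Ioi 0) μ := by
  refine Measure.integrableOn_of_bounded (M := ⌈x⌉₊) (measure_ne_top _ _)
    (measurable_kernel x).aestronglyMeasurable ?_
  filter_upwards [ae_restrict_mem measurableSet_Ioi] with y hy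
  rw [Real.norm_of_nonneg (kernel_nonneg hx hy)]
  exact kernel_le hy

lemma restrict_Ioi_eq_self {μ : Measure ℝ} (h : μ (Iic 0) = 0) : μ.restrict (Ioi 0) = μ := by
  refine Measure.restrict_eq_self_of_ae_mem ?_
  rw [ae_iff]
  convert h using 2
  ext; simp

end Kernel

/-! ### Reduction to canonical form. -/

section Canonical

/-- The function `s` for which `∫ h₀ (s - e^{-xy}) dμ = a μ(0, ∞) + ∫ kernel x dμ`. -/
noncomputable def shift (a y : ℝ) : ℝ :=
  a * Real.exp (-y) * (1 - Real.exp (-y)) + Real.exp (-y)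

lemma h₀_mul_shift_sub {y : ℝ} (hy : 0 < y) (a x : ℝ) :
    h₀ y * (shift a y - Real.exp (-(x * y))) = a + kernel x y := by
  rw [shift, kernel]
  linear_combination a * h₀_mul hy

/-- A finite measure on `(0, ∞)` is the canonical measure of a function with a prescribed value
at `1`. -/
lemma hasGIF_h₀_shift (μ : Measure ℝ) [IsFiniteMeasure μ] (h0 : μ (Iic 0) = 0) (a : ℝ) :
    HasGIF (fun x => a * μ.real univ + ∫ y in Ioi 0, kernel x y ∂μ) (shift a) h₀ μ where
  finite := inferInstance
  concentrated := h0
  measurable_s := by unfold shift; fun_prop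
  measurable_h := measurable_h₀
  nonneg_h y hy := (h₀_pos hy).le
  integrable_h := by
    refine (integrableOn_const (C := (1 : ℝ)) (measure_ne_top μ _)).congr_fun ?_
      measurableSet_Ioi
    intro y hy
    exact (h₀_mul hy).symm
  integrable_repr x := by
    refine (((integrableOn_const (C := a) (measure_ne_top μ _))).add
      (integrableOn_kernel μ x.2)).congr_fun ?_ measurableSet_Ioi
    intro y hy
    exact (h₀_mul_shift_sub hy a x).symm
  repr x := by
    have : ∫ y in Ioi 0, h₀ y * (shift a y - Real.exp (-(x * y))) ∂μ
        = ∫ y in Ioi 0, (a + kernel x y) ∂μ :=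
      setIntegral_congr_fun measurableSet_Ioi fun y hy => h₀_mul_shift_sub hy a x
    rw [this, integral_add (integrable_const a) (integrableOn_kernel μ x.2)]
    simp only [restrict_Ioi_eq_self h0, integral_const, smul_eq_mul]
    ring

/-- Every generalized integral form can be rewritten in canonical form. -/
lemma HasGIF.exists_isCanonicalMeasure {g : Ici (1 : ℝ) → ℝ} {s h : ℝ → ℝ} {μ : Measure ℝ}
    (H : HasGIF g s h μ) : ∃ ν, IsCanonicalMeasure g ν := by
  have := H.finite
  set f : ℝ → ℝ := fun y => h y * Real.exp (-y) * (1 - Real.exp (-y)) with hf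
  have hfm : Measurable f := by
    have := H.measurable_h
    fun_prop
  have hf0 : ∀ y ∈ Ioi (0 : ℝ), 0 ≤ f y := fun y hy =>
    mul_nonneg (mul_nonneg (H.nonneg_h y hy) (Real.exp_pos _).le) (one_sub_exp_neg_pos hy).le
  have hμ := restrict_Ioi_eq_self H.concentrated
  -- On `(0, ∞)` the density is `f = h / h₀`, so `h dμ = h₀ dν` with the same `s`; the integrability
  -- condition on `h` says that `ν` is finite.
  set ν : Measure ℝ := μ.withDensity fun y => (Real.toNNReal (f y) : ENNReal) with hν
  have hν0 : ν (Iic 0) = 0 := withDensity_absolutelyContinuous _ _ H.concentrated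
  have hint : Integrable f μ := by
    have := H.integrable_h
    rwa [IntegrableOn, hμ] at this
  have hνfin : IsFiniteMeasure ν := by
    refine isFiniteMeasure_withDensity_ofReal hint.2
  have hνr := restrict_Ioi_eq_self hν0
  have hmem : ∀ᵐ y ∂μ, y ∈ Ioi (0 : ℝ) := by
    rw [← hμ]; exact ae_restrict_mem measurableSet_Ioi
  have key : ∀ x : ℝ, ∀ᵐ y ∂μ, (Real.toNNReal (f y)) • (h₀ y * (s y - Real.exp (-(x * y))))
      = h y * (s y - Real.exp (-(x * y))) := by
    intro x
    filter_upwards [hmem] with y hy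
    rw [NNReal.smul_def, Real.coe_toNNReal _ (hf0 y hy), smul_eq_mul, hf]
    linear_combination h y * (s y - Real.exp (-(x * y))) * h₀_mul hy
  refine ⟨ν, s, hνfin, hν0, H.measurable_s, measurable_h₀, fun y hy => (h₀_pos hy).le,
    (hasGIF_h₀_shift ν hν0 0).integrable_h, ?_, ?_⟩
  · intro x
    rw [IntegrableOn, hνr, hν, integrable_withDensity_iff_integrable_smul hfm.real_toNNReal,
      integrable_congr (key x)]
    have := H.integrable_repr x
    rwa [IntegrableOn, hμ] at this
  · intro x
    rw [hνr, hν, integral_withDensity_eq_integral_smul hfm.real_toNNReal,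
      integral_congr_ae (key x), H.repr x, hμ]

lemma IsCanonicalMeasure.apply_eq {g : Ici (1 : ℝ) → ℝ} {μ : Measure ℝ}
    (H : IsCanonicalMeasure g μ) (x : Ici (1 : ℝ)) :
    g x = g ⟨1, mem_Ici.2 le_rfl⟩ + ∫ y in Ioi 0, kernel x y ∂μ := by
  obtain ⟨s, H⟩ := H
  have e := integral_sub (H.integrable_repr x) (H.integrable_repr ⟨1, mem_Ici.2 le_rfl⟩)
  rw [← H.repr, ← H.repr] at e
  rw [← sub_eq_iff_eq_add', ← e]
  refine integral_congr_ae (ae_of_all _ fun y => ?_)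
  simp only [kernel, one_mul]
  ring

lemma IsCanonicalMeasure.isFiniteMeasure {g : Ici (1 : ℝ) → ℝ} {μ : Measure ℝ}
    (H : IsCanonicalMeasure g μ) : IsFiniteMeasure μ := by
  obtain ⟨s, H⟩ := H
  exact H.finite

lemma IsCanonicalMeasure.concentrated {g : Ici (1 : ℝ) → ℝ} {μ : Measure ℝ}
    (H : IsCanonicalMeasure g μ) : μ (Iic 0) = 0 := by
  obtain ⟨s, H⟩ := H
  exact H.concentrated

lemma IsCanonicalMeasure.extends_eq {g : Ici (1 : ℝ) → ℝ} {μ : Measure ℝ} {m : ℕ → ℝ}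
    (H : IsCanonicalMeasure g μ) (hg : Extends g m) {k : ℕ} (hk : 1 ≤ k) :
    m k = m 1 + ∫ y in Ioi 0, kernel k y ∂μ := by
  rw [← hg k hk, H.apply_eq, ← hg 1 le_rfl]
  simp

/-- The canonical measure has the increments of `g` at the integers as its moments. -/
lemma IsCanonicalMeasure.moment {g : Ici (1 : ℝ) → ℝ} {μ : Measure ℝ} {m : ℕ → ℝ}
    (H : IsCanonicalMeasure g μ) (hg : Extends g m) (k : ℕ) :
    ∫ y, Real.exp (-y) ^ k ∂μ = m (k + 2) - m (k + 1) := by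
  have := H.isFiniteMeasure
  rw [H.extends_eq hg (by omega : 1 ≤ k + 2), H.extends_eq hg (by omega : 1 ≤ k + 1),
    add_sub_add_left_eq_sub, ← integral_sub]
  · conv_lhs => rw [← restrict_Ioi_eq_self H.concentrated]
    refine setIntegral_congr_fun measurableSet_Ioi fun y hy => ?_
    have := kernel_succ_sub hy k
    push_cast
    exact this.symm
  · exact integrableOn_kernel μ (by norm_cast; omega)
  · exact integrableOn_kernel μ (by norm_cast; omega)

end Canonical

/-! ### Uniqueness through the moment problem on `[0, 1]`. -/

section Moments

open scoped BoundedContinuousFunction Polynomial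

/-- A finite measure on `[0, 1]` is determined by its moments. -/
lemma ext_of_moments_Icc {P Q : Measure (Icc (0 : ℝ) 1)} [IsFiniteMeasure P] [IsFiniteMeasure Q]
    (h : ∀ n : ℕ, ∫ x, (x : ℝ) ^ n ∂P = ∫ x, (x : ℝ) ^ n ∂Q) : P = Q := by
  -- The polynomial functions: they separate points, and their integrals are combinations of
  -- moments.
  let A : StarSubalgebra ℝ (Icc (0 : ℝ) 1 →ᵇ ℝ) :=
    { carrier := {f | ∃ p : ℝ[X], ∀ x, f x = p.eval (x : ℝ)}
      mul_mem' := by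
        rintro f g ⟨p, hp⟩ ⟨q, hq⟩
        exact ⟨p * q, fun x => by simp [hp, hq]⟩
      add_mem' := by
        rintro f g ⟨p, hp⟩ ⟨q, hq⟩
        exact ⟨p + q, fun x => by simp [hp, hq]⟩
      algebraMap_mem' := fun r => ⟨Polynomial.C r, fun x => by simp⟩
      star_mem' := by
        rintro f ⟨p, hp⟩
        exact ⟨p, fun x => by simp [hp]⟩ }
  refine ext_of_forall_mem_subalgebra_integral_eq_of_polish (A := A) ?_ ?_
  · intro x y hxy
    let i : Icc (0 : ℝ) 1 →ᵇ ℝ := BoundedContinuousFunction.mkOfCompact ⟨Subtype.val, by fun_prop⟩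
    refine ⟨i, ⟨i.toContinuousMap, ⟨i, ⟨Polynomial.X, fun x => by simp [i]⟩, rfl⟩, rfl⟩, ?_⟩
    simpa [i, Subtype.ext_iff] using hxy
  · rintro f ⟨p, hp⟩
    have hint : ∀ (R : Measure (Icc (0 : ℝ) 1)) [IsFiniteMeasure R] (i : ℕ),
        Integrable (fun x : Icc (0 : ℝ) 1 => p.coeff i * (x : ℝ) ^ i) R := fun R _ i =>
      (BoundedContinuousFunction.mkOfCompact
        (⟨fun x : Icc (0 : ℝ) 1 => p.coeff i * (x : ℝ) ^ i, by fun_prop⟩ :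
          C(Icc (0 : ℝ) 1, ℝ))).integrable R
    simp_rw [hp, Polynomial.eval_eq_sum_range]
    rw [integral_finsetSum _ fun i _ => hint P i, integral_finsetSum _ fun i _ => hint Q i]
    simp_rw [integral_const_mul, h]

/-- A finite measure on `(0, ∞)` is determined by its Laplace transform at the integers. -/
lemma ext_of_exp_moments {μ ν : Measure ℝ} [IsFiniteMeasure μ] [IsFiniteMeasure ν]
    (hμ : μ (Iic 0) = 0) (hν : ν (Iic 0) = 0)
    (h : ∀ n : ℕ, ∫ y, Real.exp (-y) ^ n ∂μ = ∫ y, Real.exp (-y) ^ n ∂ν) : μ = ν := by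
  -- The clamp only makes `e^{-y}` total as a map into `[0, 1]`; on `(0, ∞)` it is inactive and
  -- `-log` inverts `p`.
  let p : ℝ → Icc (0 : ℝ) 1 := fun y => projIcc 0 1 zero_le_one (Real.exp (-y))
  have hp : Measurable p := (continuous_projIcc.comp (by fun_prop)).measurable
  have hpy : ∀ y ∈ Ioi (0 : ℝ), (p y : ℝ) = Real.exp (-y) := fun y hy => by
    simp only [p]
    rw [projIcc_of_mem zero_le_one ⟨(Real.exp_pos _).le, (exp_neg_lt_one hy).le⟩]
  have mom : ∀ (ρ : Measure ℝ), ρ (Iic 0) = 0 → ∀ n : ℕ,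
      ∫ x, (x : ℝ) ^ n ∂(ρ.map p) = ∫ y, Real.exp (-y) ^ n ∂ρ := by
    intro ρ hρ n
    rw [integral_map hp.aemeasurable (by fun_prop), ← restrict_Ioi_eq_self hρ]
    exact setIntegral_congr_fun measurableSet_Ioi fun y hy => by simp only [hpy y hy]
  have recover : ∀ (ρ : Measure ℝ), ρ (Iic 0) = 0 →
      (ρ.map p).map (fun x : Icc (0 : ℝ) 1 => -Real.log (x : ℝ)) = ρ := by
    intro ρ hρ
    rw [Measure.map_map (by fun_prop) hp]
    conv_rhs => rw [← Measure.map_id (μ := ρ)]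
    refine Measure.map_congr ?_
    rw [← restrict_Ioi_eq_self hρ]
    filter_upwards [ae_restrict_mem measurableSet_Ioi] with y hy
    simp [hpy y hy]
  have : μ.map p = ν.map p := ext_of_moments_Icc fun n => by rw [mom μ hμ, mom ν hν, h]
  rw [← recover μ hμ, ← recover ν hν, this]

lemma IsCanonicalMeasure.eq_of_extends {g₁ g₂ : Ici (1 : ℝ) → ℝ} {μ₁ μ₂ : Measure ℝ} {m : ℕ → ℝ}
    (H₁ : IsCanonicalMeasure g₁ μ₁) (H₂ : IsCanonicalMeasure g₂ μ₂)
    (h₁ : Extends g₁ m) (h₂ : Extends g₂ m) : μ₁ = μ₂ := by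
  have := H₁.isFiniteMeasure
  have := H₂.isFiniteMeasure
  exact ext_of_exp_moments H₁.concentrated H₂.concentrated fun n => by
    rw [H₁.moment h₁, H₂.moment h₂]

lemma IsCanonicalMeasure.unique {g : Ici (1 : ℝ) → ℝ} {μ₁ μ₂ : Measure ℝ}
    (H₁ : IsCanonicalMeasure g μ₁) (H₂ : IsCanonicalMeasure g μ₂) : μ₁ = μ₂ := by
  have hg : Extends g fun k => if hk : 1 ≤ k then
      g ⟨(k : ℝ), mem_Ici.2 (Nat.one_le_cast.2 hk)⟩ else 0 := fun k hk => by simp [hk]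
  exact H₁.eq_of_extends H₂ hg hg

lemma existsUnique_isCanonicalMeasure {g : Ici (1 : ℝ) → ℝ} (hg : g ∈ classGStar) :
    ∃! μ : Measure ℝ, IsCanonicalMeasure g μ := by
  obtain ⟨⟨s, h, μ, H⟩, -⟩ := hg
  obtain ⟨ν, hν⟩ := H.exists_isCanonicalMeasure
  exact ⟨ν, hν, fun ν' hν' => hν'.unique hν⟩

lemma eq_of_extends {g₁ g₂ : Ici (1 : ℝ) → ℝ} {m : ℕ → ℝ} (hg₁ : g₁ ∈ classGStar)
    (hg₂ : g₂ ∈ classGStar) (h₁ : Extends g₁ m) (h₂ : Extends g₂ m) : g₁ = g₂ := by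
  obtain ⟨μ₁, H₁, -⟩ := existsUnique_isCanonicalMeasure hg₁
  obtain ⟨μ₂, H₂, -⟩ := existsUnique_isCanonicalMeasure hg₂
  obtain rfl := H₁.eq_of_extends H₂ h₁ h₂
  funext x
  have e₁ := h₁ 1 le_rfl
  have e₂ := h₂ 1 le_rfl
  simp only [Nat.cast_one] at e₁ e₂
  rw [H₁.apply_eq, H₂.apply_eq, e₁, e₂]

end Moments

/-! ### Expected maxima in terms of the distribution function. -/

section ExpectedMax

variable {Ω : Type*} [MeasurableSpace Ω] {P : Measure Ω} {X : Ω → ℝ}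

/-- Fubini applied to `Z = ∫ (1_{x < Z} - 1_{x < 0}) dx`; the second indicator makes the integral
converge for `Z` of either sign. It does not depend on `Z`, so it cancels when two expected maxima
are compared. -/
lemma integral_tail [IsProbabilityMeasure P] {Z : Ω → ℝ} (hZ : Measurable Z)
    (hi : Integrable Z P) :
    Integrable (fun x : ℝ => P.real {ω | x < Z ω} - (if x < 0 then 1 else 0)) ∧
      ∫ x : ℝ, (P.real {ω | x < Z ω} - (if x < 0 then 1 else 0)) = ∫ ω, Z ω ∂P := by
  let K : Ω → ℝ → ℝ := fun ω x => (if x < Z ω then 1 else 0) - (if x < 0 then 1 else 0)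
  have hK : Measurable (Function.uncurry K) := by
    refine Measurable.sub (Measurable.ite ?_ measurable_const measurable_const)
      (Measurable.ite ?_ measurable_const measurable_const)
    · exact measurableSet_lt measurable_snd (hZ.comp measurable_fst)
    · exact measurableSet_lt measurable_snd measurable_const
  have hKi : ∀ ω, K ω = fun x => (Ico 0 (Z ω)).indicator 1 x - (Ico (Z ω) 0).indicator 1 x := by
    intro ω
    funext x
    simp only [K, indicator, mem_Ico, Pi.one_apply]
    split_ifs <;> grind
  -- At most one of the two intervals is nonempty, so the norm turns the difference into a sum, with
  -- integral `|Z ω|`.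
  have hKn : ∀ ω, (fun x => ‖K ω x‖)
      = fun x => (Ico 0 (Z ω)).indicator 1 x + (Ico (Z ω) 0).indicator 1 x := by
    intro ω
    funext x
    simp only [K, indicator, mem_Ico, Pi.one_apply]
    split_ifs <;> first | simp; done | grind
  have hI : ∀ a b : ℝ, Integrable ((Ico a b).indicator (1 : ℝ → ℝ)) := fun a b =>
    (integrable_indicator_iff measurableSet_Ico).2 (integrableOn_const (by simp))
  have hprod : Integrable (Function.uncurry K) (P.prod volume) := by
    rw [integrable_prod_iff hK.aestronglyMeasurable]
    refine ⟨ae_of_all _ fun ω => ?_, ?_⟩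
    · change Integrable (K ω) volume
      rw [hKi]
      exact (hI _ _).sub (hI _ _)
    · refine hi.abs.congr (ae_of_all _ fun ω => ?_)
      change _ = ∫ x, ‖K ω x‖
      rw [hKn, integral_add (hI _ _) (hI _ _), integral_indicator_one measurableSet_Ico,
        integral_indicator_one measurableSet_Ico, measureReal_def, measureReal_def,
        Real.volume_Ico, Real.volume_Ico, ENNReal.toReal_ofReal', ENNReal.toReal_ofReal']
      grind
  have hx : ∀ x : ℝ, ∫ ω, K ω x ∂P = P.real {ω | x < Z ω} - (if x < 0 then 1 else 0) := by
    intro x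
    have hs : MeasurableSet {ω | x < Z ω} := measurableSet_lt measurable_const hZ
    have : (fun ω => K ω x)
        = fun ω => {ω | x < Z ω}.indicator 1 ω - (if x < 0 then (1 : ℝ) else 0) := by
      funext ω
      simp [K, indicator]
    rw [this, integral_sub ((integrable_indicator_iff hs).2 (integrableOn_const (by simp)))
      (integrable_const _), integral_indicator_one hs]
    simp
  simp_rw [← hx]
  refine ⟨hprod.integral_prod_right, ?_⟩
  rw [← integral_integral_swap hprod]
  refine integral_congr_ae (ae_of_all _ fun ω => ?_)
  simp only
  rw [hKi, integral_sub (hI _ _) (hI _ _), integral_indicator_one measurableSet_Ico,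
    integral_indicator_one measurableSet_Ico, measureReal_def, measureReal_def,
    Real.volume_Ico, Real.volume_Ico, ENNReal.toReal_ofReal', ENNReal.toReal_ofReal']
  grind

lemma measurable_iSup_eval (hX : Measurable X) (k : ℕ) :
    Measurable fun ω : Fin k → Ω => ⨆ i, X (ω i) :=
  Measurable.iSup fun i => hX.comp (measurable_pi_apply i)

lemma iSup_le_iff_forall {k : ℕ} (hk : 1 ≤ k) (f : Fin k → ℝ) (x : ℝ) :
    ⨆ i, f i ≤ x ↔ ∀ i, f i ≤ x := by
  have : Nonempty (Fin k) := ⟨⟨0, hk⟩⟩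
  exact ciSup_le_iff (finite_range f).bddAbove

lemma integrable_iSup_eval [IsProbabilityMeasure P] (hX : Measurable X) (hi : Integrable X P)
    {k : ℕ} (hk : 1 ≤ k) :
    Integrable (fun ω : Fin k → Ω => ⨆ i, X (ω i)) (Measure.pi fun _ => P) := by
  have : Nonempty (Fin k) := ⟨⟨0, hk⟩⟩
  have hs : Integrable (fun ω : Fin k → Ω => ∑ i, |X (ω i)|) (Measure.pi fun _ => P) :=
    integrable_finsetSum _ fun i _ =>
      ((measurePreserving_eval (fun _ : Fin k => P) i).integrable_comp
        hi.abs.aestronglyMeasurable).2 hi.abs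
  refine hs.mono' (measurable_iSup_eval hX k).aestronglyMeasurable (ae_of_all _ fun ω => ?_)
  obtain ⟨i, hi⟩ := exists_eq_ciSup_of_finite (f := fun i => X (ω i))
  rw [← hi, Real.norm_eq_abs]
  exact Finset.single_le_sum (f := fun i => |X (ω i)|) (fun _ _ => abs_nonneg _)
    (Finset.mem_univ i)

lemma pi_real_iSup_le [IsProbabilityMeasure P] {k : ℕ} (hk : 1 ≤ k) (x : ℝ) :
    (Measure.pi fun _ : Fin k => P).real {ω | ⨆ i, X (ω i) ≤ x} = P.real {ω | X ω ≤ x} ^ k := by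
  have : {ω : Fin k → Ω | ⨆ i, X (ω i) ≤ x} = univ.pi fun _ => {ω | X ω ≤ x} := by
    ext ω
    simp [iSup_le_iff_forall hk]
  rw [this, measureReal_def, Measure.pi_pi]
  simp [measureReal_def]

lemma cdf_map_eq [IsProbabilityMeasure P] (hX : Measurable X) (x : ℝ) :
    cdf (P.map X) x = P.real {ω | X ω ≤ x} := by
  have := Measure.isProbabilityMeasure_map (μ := P) hX.aemeasurable
  rw [cdf_eq_real, map_measureReal_apply hX measurableSet_Iic]
  rfl

lemma expectedMax_eq_integral_cdf [IsProbabilityMeasure P] (hX : Measurable X)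
    (hi : Integrable X P) {k : ℕ} (hk : 1 ≤ k) :
    Integrable (fun x : ℝ => 1 - cdf (P.map X) x ^ k - (if x < 0 then 1 else 0)) ∧
      ∫ x : ℝ, (1 - cdf (P.map X) x ^ k - (if x < 0 then 1 else 0)) = expectedMax P X k := by
  have h := integral_tail (measurable_iSup_eval hX k) (integrable_iSup_eval hX hi hk)
  have : ∀ x : ℝ, (Measure.pi fun _ : Fin k => P).real {ω | x < ⨆ i, X (ω i)}
      = 1 - cdf (P.map X) x ^ k := by
    intro x
    rw [cdf_map_eq hX, ← pi_real_iSup_le hk, ← probReal_compl_eq_one_sub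
      (measurableSet_le (measurable_iSup_eval hX k) measurable_const)]
    congr 1
    ext
    simp
  simp_rw [this] at h
  exact h

lemma integrable_cdf_sub_pow [IsProbabilityMeasure P] (hX : Measurable X)
    (hi : Integrable X P) {k : ℕ} (hk : 1 ≤ k) :
    Integrable fun x : ℝ => cdf (P.map X) x - cdf (P.map X) x ^ k := by
  convert (expectedMax_eq_integral_cdf hX hi hk).1.sub
    (expectedMax_eq_integral_cdf hX hi le_rfl).1 using 2
  simp only [Pi.sub_apply]
  ring

lemma integral_cdf_sub_pow [IsProbabilityMeasure P] (hX : Measurable X)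
    (hi : Integrable X P) {k : ℕ} (hk : 1 ≤ k) :
    ∫ x : ℝ, (cdf (P.map X) x - cdf (P.map X) x ^ k) = expectedMax P X k - expectedMax P X 1 := by
  rw [← (expectedMax_eq_integral_cdf hX hi hk).2, ← (expectedMax_eq_integral_cdf hX hi le_rfl).2,
    ← integral_sub (expectedMax_eq_integral_cdf hX hi hk).1
      (expectedMax_eq_integral_cdf hX hi le_rfl).1]
  refine integral_congr_ae (ae_of_all _ fun x => ?_)
  simp only
  ring

/-- A non-degenerate random variable lies with positive probability on either side of its mean. -/
lemma integral_cdf_mul_pos [IsProbabilityMeasure P] (hX : Measurable X) (hi : Integrable X P)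
    (hn : ¬ ∃ c : ℝ, ∀ᵐ ω ∂P, X ω = c) :
    0 < ∫ x : ℝ, cdf (P.map X) x * (1 - cdf (P.map X) x) := by
  set F := cdf (P.map X) with hF
  set c := ∫ ω, X ω ∂P with hc
  have hint : Integrable fun x : ℝ => F x * (1 - F x) := by
    convert integrable_cdf_sub_pow hX hi one_le_two using 2
    ring
  have h0 : ∀ x, 0 ≤ F x * (1 - F x) := fun x =>
    mul_nonneg (cdf_nonneg _ _) (sub_nonneg.2 (cdf_le_one _ _))
  have hsub : Integrable (fun ω => X ω - c) P := hi.sub (integrable_const c)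
  have hint0 : ∫ ω, (X ω - c) ∂P = 0 := by
    rw [integral_sub hi (integrable_const c)]
    simp [hc]
  have hlt : P {ω | X ω < c} ≠ 0 := by
    intro hz
    have hae : ∀ᵐ ω ∂P, 0 ≤ X ω - c := by
      rw [ae_iff]
      convert hz using 2
      ext
      simp
    refine hn ⟨c, ?_⟩
    filter_upwards [(integral_eq_zero_iff_of_nonneg_ae hae hsub).1 hint0] with ω hω
    simp only [Pi.zero_apply] at hω
    linarith
  have hgt : P {ω | c < X ω} ≠ 0 := by
    intro hz
    have hae : ∀ᵐ ω ∂P, 0 ≤ c - X ω := by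
      rw [ae_iff]
      convert hz using 2
      ext
      simp
    have hint1 : ∫ ω, (c - X ω) ∂P = 0 := by
      rw [← neg_eq_zero, ← integral_neg, ← hint0]
      simp
    refine hn ⟨c, ?_⟩
    filter_upwards [(integral_eq_zero_iff_of_nonneg_ae hae ((integrable_const c).sub hi)).1 hint1]
      with ω hω
    simp only [Pi.zero_apply] at hω
    linarith
  -- Continuity from below supplies an interval of positive length ending at the mean on which `F`
  -- is neither `0` nor `1`.
  obtain ⟨n, hn'⟩ : ∃ n : ℕ, P {ω | X ω ≤ c - 1 / ((n : ℝ) + 1)} ≠ 0 := by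
    by_contra! hall
    refine hlt (measure_mono_null ?_ (measure_iUnion_null hall))
    intro ω hω
    obtain ⟨n, hn⟩ := exists_nat_one_div_lt (sub_pos.2 (show X ω < c from hω))
    exact mem_iUnion.2 ⟨n, show X ω ≤ _ by linarith⟩
  rw [integral_pos_iff_support_of_nonneg h0 hint]
  have hvol : 0 < volume (Ioo (c - 1 / ((n : ℝ) + 1)) c) := by
    rw [Real.volume_Ioo, ENNReal.ofReal_pos]
    have : (0 : ℝ) < 1 / ((n : ℝ) + 1) := by positivity
    linarith
  refine hvol.trans_le (measure_mono fun x hx => ?_)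
  have h1 : F x ≠ 0 := by
    rw [hF, cdf_map_eq hX, measureReal_ne_zero_iff]
    exact fun hz => hn' (measure_mono_null (fun ω hω => le_trans hω hx.1.le) hz)
  have h2 : 1 - F x ≠ 0 := by
    rw [hF, cdf_map_eq hX, ← probReal_compl_eq_one_sub (measurableSet_le hX measurable_const),
      measureReal_ne_zero_iff]
    refine fun hz => hgt (measure_mono_null (fun ω hω => ?_) hz)
    simp only [mem_compl_iff, mem_ofPred_eq, not_le] at hω ⊢
    exact hx.2.trans hω
  exact mul_ne_zero h1 h2

end ExpectedMax

/-! ### The laws of `V` and `Y`, and the effect of symmetry. -/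

section Law

variable {Ω : Type*} [MeasurableSpace Ω] {P : Measure Ω} {X : Ω → ℝ} {l : ℝ}

/-- The density of `V`. -/
noncomputable def densV (P : Measure Ω) (X : Ω → ℝ) (l x : ℝ) : ℝ :=
  1 / l * (cdf (P.map X) x * (1 - cdf (P.map X) x))

lemma measurable_cdf (ρ : Measure ℝ) : Measurable (cdf ρ) := (monotone_cdf ρ).measurable

lemma measurable_densV : Measurable (densV P X l) := by
  unfold densV
  have := measurable_cdf (P.map X)
  fun_prop

lemma densV_nonneg (hl : 0 < l) (x : ℝ) : 0 ≤ densV P X l x :=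
  mul_nonneg (by positivity) (mul_nonneg (cdf_nonneg _ _) (sub_nonneg.2 (cdf_le_one _ _)))

lemma lawV_eq : lawV P X l = volume.withDensity fun x => ENNReal.ofReal (densV P X l x) := rfl

lemma measurable_neg_log_cdf : Measurable fun v => -Real.log (cdf (P.map X) v) := by
  have := measurable_cdf (P.map X)
  fun_prop

lemma isProbabilityMeasure_lawV (hl : 0 < l)
    (hi : Integrable fun x : ℝ => cdf (P.map X) x * (1 - cdf (P.map X) x))
    (he : ∫ x : ℝ, cdf (P.map X) x * (1 - cdf (P.map X) x) = l) :
    IsProbabilityMeasure (lawV P X l) := by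
  constructor
  rw [lawV_eq, withDensity_apply _ MeasurableSet.univ, Measure.restrict_univ,
    ← ofReal_integral_eq_lintegral_ofReal (f := densV P X l) (hi.const_mul (1 / l))
      (ae_of_all _ (densV_nonneg hl))]
  simp only [densV]
  rw [integral_const_mul, he, one_div, inv_mul_cancel₀ hl.ne', ENNReal.ofReal_one]

lemma ae_lawV_cdf_mem : ∀ᵐ v ∂lawV P X l, cdf (P.map X) v ∈ Ioo (0 : ℝ) 1 := by
  rw [lawV_eq, ae_withDensity_iff measurable_densV.ennreal_ofReal]
  refine ae_of_all _ fun v hv => ?_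
  have h1 : cdf (P.map X) v ≠ 0 := fun h => hv (by simp [densV, h])
  have h2 : cdf (P.map X) v ≠ 1 := fun h => hv (by simp [densV, h])
  exact ⟨(cdf_nonneg _ _).lt_of_ne h1.symm, (cdf_le_one _ _).lt_of_ne h2⟩

lemma lawY_Iic_zero : lawY P X l (Iic 0) = 0 := by
  rw [lawY, Measure.map_apply measurable_neg_log_cdf measurableSet_Iic]
  refine measure_mono_null ?_ (ae_iff.1 ae_lawV_cdf_mem)
  intro v hv hmem
  have := Real.log_neg hmem.1 hmem.2
  simp only [mem_preimage, mem_Iic] at hv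
  linarith

lemma cdf_mul_kernel {t : ℝ} (h0 : 0 ≤ t) (h1 : t ≤ 1) {k : ℕ} (hk : 1 ≤ k) :
    t * (1 - t) * kernel k (-Real.log t) = t - t ^ k := by
  -- At the endpoints the factor `t (1 - t)` hides the junk values of `log` and `h₀`; at `t = 0` the
  -- right side vanishes because `k ≥ 1`.
  rcases h0.eq_or_lt with rfl | h0
  · simp [zero_pow (by omega : k ≠ 0)]
  rcases h1.eq_or_lt with rfl | h1
  · simp
  have e : Real.exp (-(k * -Real.log t)) = t ^ k := by
    rw [mul_neg, neg_neg, Real.exp_nat_mul, Real.exp_log h0]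
  rw [kernel, h₀_eq, e, neg_neg, Real.exp_log h0]
  have := sub_pos.2 h1
  field_simp

lemma integral_kernel_lawY (hl : 0 < l) {k : ℕ} (hk : 1 ≤ k) :
    l * ∫ y in Ioi 0, kernel k y ∂lawY P X l
      = ∫ x : ℝ, (cdf (P.map X) x - cdf (P.map X) x ^ k) := by
  rw [restrict_Ioi_eq_self lawY_Iic_zero, lawY, integral_map measurable_neg_log_cdf.aemeasurable
    (measurable_kernel _).aestronglyMeasurable, lawV_eq,
    integral_withDensity_eq_integral_toReal_smul measurable_densV.ennreal_ofReal
      (ae_of_all _ fun _ => ENNReal.ofReal_lt_top), ← integral_const_mul]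
  refine integral_congr_ae (ae_of_all _ fun x => ?_)
  simp only
  rw [ENNReal.toReal_ofReal (densV_nonneg hl x), smul_eq_mul, densV,
    ← cdf_mul_kernel (cdf_nonneg (P.map X) x) (cdf_le_one (P.map X) x) hk]
  field_simp

/-- Symmetry gives `P (X ≤ 2c - v) = P (X ≥ v)`, which is `1 - F v` unless `v` is an atom. Atoms are
countable, hence Lebesgue null, which suffices because `V` has a density. -/
lemma cdf_reflect [IsProbabilityMeasure P] {c : ℝ} (hX : Measurable X)
    (hs : IdentDistrib (fun ω => X ω - c) (fun ω => c - X ω) P P) :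
    ∀ᵐ v : ℝ, cdf (P.map X) (2 * c - v) = 1 - cdf (P.map X) v := by
  have hcount : {t : ℝ | 0 < P {ω | X ω = t}}.Countable :=
    Measure.countable_meas_level_set_pos hX
  filter_upwards [hcount.ae_notMem volume] with v hv
  have hv0 : P {ω | X ω = v} = 0 := by simpa using hv
  have e1 : P {ω | X ω ≤ 2 * c - v} = P {ω | v ≤ X ω} := by
    have := hs.measure_mem_eq (s := Iic (c - v)) measurableSet_Iic
    convert this using 2 <;> ext ω <;>
      simp only [mem_ofPred_eq, mem_preimage, mem_Iic] <;> constructor <;> intro h <;> linarith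
  have e2 : P {ω | v ≤ X ω} = P {ω | v < X ω} := by
    refine measure_congr ?_
    have hne : ∀ᵐ ω ∂P, X ω ≠ v := by
      rw [ae_iff]
      simpa using hv0
    filter_upwards [hne] with ω hω
    exact propext ⟨fun h => lt_of_le_of_ne h hω.symm, le_of_lt⟩
  rw [cdf_map_eq hX, cdf_map_eq hX, ← probReal_compl_eq_one_sub
    (measurableSet_le hX measurable_const), measureReal_def, measureReal_def, e1, e2]
  congr 2
  ext
  simp

/-- `F (1 - F)` is unchanged when `F` becomes `1 - F`, and Lebesgue measure is invariant under `v ↦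
2c - v`. -/
lemma lawV_preimage_reflect {c : ℝ}
    (hF : ∀ᵐ v : ℝ, cdf (P.map X) (2 * c - v) = 1 - cdf (P.map X) v) {A : Set ℝ}
    (hA : MeasurableSet A) : lawV P X l ((fun v => 2 * c - v) ⁻¹' A) = lawV P X l A := by
  have hmp := Measure.measurePreserving_sub_left (volume : Measure ℝ) (2 * c)
  rw [lawV_eq, withDensity_apply _ hA, withDensity_apply _ (hmp.measurable hA),
    ← hmp.setLIntegral_comp_preimage hA measurable_densV.ennreal_ofReal]
  refine lintegral_congr_ae (ae_restrict_of_ae ?_)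
  filter_upwards [hF] with v hv
  simp only [densV, hv]
  ring_nf

/-- `Y ≤ y` means `F V ≥ e^{-y}`. Reflecting `V` turns this into `F V ≤ 1 - e^{-y}`, that is `Y ≥
-log (1 - e^{-y})`. -/
lemma isReflectionInvariant_lawY {c : ℝ}
    (hF : ∀ᵐ v : ℝ, cdf (P.map X) (2 * c - v) = 1 - cdf (P.map X) v) :
    IsReflectionInvariant (lawY P X l) := by
  intro y hy
  have hm := measurable_neg_log_cdf (P := P) (X := X)
  rw [lawY, Measure.map_apply hm measurableSet_Ioc, Measure.map_apply hm measurableSet_Ici,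
    ← lawV_preimage_reflect hF (hm measurableSet_Ioc)]
  refine measure_congr ?_
  have hF' : ∀ᵐ v ∂lawV P X l, cdf (P.map X) (2 * c - v) = 1 - cdf (P.map X) v :=
    (withDensity_absolutelyContinuous _ _).ae_le hF
  filter_upwards [hF', ae_lawV_cdf_mem] with v hv hmem
  have h1 := sub_pos.2 hmem.2
  have h2 := one_sub_exp_neg_pos hy
  refine propext ?_
  change -Real.log (cdf (P.map X) (2 * c - v)) ∈ Ioc 0 y ↔
    -Real.log (cdf (P.map X) v) ∈ Ici (-Real.log (1 - Real.exp (-y)))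
  rw [hv, mem_Ioc, mem_Ici, neg_le_neg_iff, Real.log_le_log_iff hmem.1 h2, neg_le,
    Real.le_log_iff_exp_le h1]
  have h3 := Real.log_neg h1 (by linarith [hmem.1])
  constructor
  · rintro ⟨-, h⟩
    linarith
  · intro h
    exact ⟨by linarith, by linarith⟩

end Law

/-! ### From a symmetric variable to its extension. -/

section Forward

variable {Ω : Type*} [MeasurableSpace Ω] {P : Measure Ω} [IsProbabilityMeasure P] {X : Ω → ℝ}
  {m : ℕ → ℝ}

lemma integrable_cdf_mul (hX : Measurable X) (hi : Integrable X P) :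
    Integrable fun x : ℝ => cdf (P.map X) x * (1 - cdf (P.map X) x) := by
  convert integrable_cdf_sub_pow hX hi one_le_two using 2
  ring

lemma IsEMSOf.integral_cdf_mul (hm : IsEMSOf P X m) (hX : Measurable X) (hi : Integrable X P) :
    ∫ x : ℝ, cdf (P.map X) x * (1 - cdf (P.map X) x) = m 2 - m 1 := by
  rw [hm 2 one_le_two, hm 1 le_rfl, ← integral_cdf_sub_pow hX hi one_le_two]
  congr 1
  ext
  ring

lemma IsEMSOf.sub_pos (hm : IsEMSOf P X m) (hs : IsSymmetricNondegenerate P X) :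
    0 < m 2 - m 1 := by
  rw [← hm.integral_cdf_mul hs.measurable hs.integrable]
  exact integral_cdf_mul_pos hs.measurable hs.integrable hs.nondegenerate

lemma IsEMSOf.isProbabilityMeasure_lawV (hm : IsEMSOf P X m) (hs : IsSymmetricNondegenerate P X) :
    IsProbabilityMeasure (lawV P X (m 2 - m 1)) :=
  EMS.isProbabilityMeasure_lawV (hm.sub_pos hs) (integrable_cdf_mul hs.measurable hs.integrable)
    (hm.integral_cdf_mul hs.measurable hs.integrable)

lemma IsEMSOf.isProbabilityMeasure_lawY (hm : IsEMSOf P X m) (hs : IsSymmetricNondegenerate P X) :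
    IsProbabilityMeasure (lawY P X (m 2 - m 1)) :=
  have := hm.isProbabilityMeasure_lawV hs
  Measure.isProbabilityMeasure_map measurable_neg_log_cdf.aemeasurable

/-- The extension of the expected maxima sequence of `X`, together with its canonical measure. -/
lemma IsEMSOf.exists_extension (hm : IsEMSOf P X m) (hs : IsSymmetricNondegenerate P X) :
    ∃ g ∈ classGStar, Extends g m ∧
      HasGIF g (shift (m 1 / (m 2 - m 1))) h₀
        (ENNReal.ofReal (m 2 - m 1) • lawY P X (m 2 - m 1)) := by
  have hl := hm.sub_pos hs
  have := hm.isProbabilityMeasure_lawY hs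
  set l := m 2 - m 1
  have hfin : IsFiniteMeasure (ENNReal.ofReal l • lawY P X l) :=
    Measure.smul_finite _ ENNReal.ofReal_ne_top
  -- The measure has total mass `l`, so the coefficient `m 1 / l` produces the value `m 1` at `x =
  -- 1`.
  have H := hasGIF_h₀_shift (ENNReal.ofReal l • lawY P X l)
    (by simp [lawY_Iic_zero]) (m 1 / l)
  have hreal : (ENNReal.ofReal l • lawY P X l).real univ = l := by
    simp [measureReal_def, hl.le]
  have hext : Extends (fun x => m 1 / l * (ENNReal.ofReal l • lawY P X l).real univ
      + ∫ y in Ioi 0, kernel x y ∂(ENNReal.ofReal l • lawY P X l)) m := by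
    intro k hk
    simp only
    rw [hreal, div_mul_cancel₀ _ hl.ne', Measure.restrict_smul, integral_smul_measure,
      ENNReal.toReal_ofReal hl.le, smul_eq_mul, integral_kernel_lawY hl hk,
      integral_cdf_sub_pow hs.measurable hs.integrable hk, hm k hk, hm 1 le_rfl]
    ring
  refine ⟨_, ⟨⟨_, _, _, H⟩, ?_⟩, hext, H⟩
  rintro ⟨c, hc⟩
  have e1 := hext 1 le_rfl
  have e2 := hext 2 one_le_two
  have := e1.symm.trans ((hc _).trans ((hc _).symm.trans e2))
  linarith

lemma IsSymmetricNondegenerate.isReflectionInvariant_lawY (hs : IsSymmetricNondegenerate P X)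
    (l : ℝ) : IsReflectionInvariant (lawY P X l) :=
  EMS.isReflectionInvariant_lawY (cdf_reflect hs.measurable hs.symmetric)

lemma IsReflectionInvariant.smul {μ : Measure ℝ} (h : IsReflectionInvariant μ) (r : ENNReal) :
    IsReflectionInvariant (r • μ) := fun y hy => by
  simp [h y hy]

/-- By uniqueness `g` is the extension already constructed; the factor `l` moves from the measure
into the integrand. -/
lemma IsEMSOf.explicit_form (hm : IsEMSOf P X m) (hs : IsSymmetricNondegenerate P X)
    {g : Ici (1 : ℝ) → ℝ} (hg : g ∈ classGStar) (hgm : Extends g m) (x : Ici (1 : ℝ)) :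
    IntegrableOn
      (fun y : ℝ => (m 2 - m 1) * Real.exp y / (1 - Real.exp (-y)) *
        (m 1 / (m 2 - m 1) * Real.exp (-y) * (1 - Real.exp (-y))
          + Real.exp (-y) - Real.exp (-((x : ℝ) * y))))
      (Ioi 0) (lawY P X (m 2 - m 1)) ∧
    g x = ∫ y in Ioi 0, (m 2 - m 1) * Real.exp y / (1 - Real.exp (-y)) *
        (m 1 / (m 2 - m 1) * Real.exp (-y) * (1 - Real.exp (-y))
          + Real.exp (-y) - Real.exp (-((x : ℝ) * y)))
      ∂(lawY P X (m 2 - m 1)) := by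
  obtain ⟨g', hg', hgm', H⟩ := hm.exists_extension hs
  obtain rfl := eq_of_extends hg hg' hgm hgm'
  have hl := hm.sub_pos hs
  set l := m 2 - m 1
  have e : ∀ y : ℝ, l * Real.exp y / (1 - Real.exp (-y)) *
      (m 1 / l * Real.exp (-y) * (1 - Real.exp (-y)) + Real.exp (-y) - Real.exp (-((x : ℝ) * y)))
      = l * (h₀ y * (shift (m 1 / l) y - Real.exp (-(x * y)))) := fun y => by
    rw [h₀, shift]
    ring
  simp_rw [e]
  have hi := H.integrable_repr x
  have hr := H.repr x
  rw [IntegrableOn, Measure.restrict_smul, integrable_smul_measure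
    (ENNReal.ofReal_pos.2 hl).ne' ENNReal.ofReal_ne_top] at hi
  rw [Measure.restrict_smul, integral_smul_measure, ENNReal.toReal_ofReal hl.le,
    smul_eq_mul, ← integral_const_mul] at hr
  exact ⟨hi.const_mul l, hr⟩

end Forward

/-! ### The quantile function built from a measure. -/

section Quantile

/-- The integrand of the quantile function: `h₀ y` times the centred indicator of `e^{-y} < u`. -/
noncomputable def quantKernel (u y : ℝ) : ℝ :=
  h₀ y * ((if Real.exp (-y) < u then 1 else 0) - (1 - Real.exp (-y)))

/-- The quantile function with mean `a` whose differential is the image of `h₀ μ` under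
`y ↦ e^{-y}`. -/
noncomputable def quant (a : ℝ) (μ : Measure ℝ) (u : ℝ) : ℝ := a + ∫ y, quantKernel u y ∂μ

lemma measurable_uncurry_quantKernel : Measurable (Function.uncurry quantKernel) := by
  refine (measurable_h₀.comp measurable_snd).mul (Measurable.sub
    (Measurable.ite (measurableSet_lt (by fun_prop) measurable_fst) measurable_const
      measurable_const) (by fun_prop))

lemma measurable_quant (a : ℝ) (μ : Measure ℝ) [SFinite μ] : Measurable (quant a μ) :=
  (measurable_uncurry_quantKernel.stronglyMeasurable.integral_prod_right).measurable.const_add a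

lemma ae_pos {μ : Measure ℝ} (h : μ (Iic 0) = 0) : ∀ᵐ y ∂μ, 0 < y := by
  rw [ae_iff]
  convert h using 2
  ext
  simp

/-- For fixed `u` the integrand is bounded: it is `1 / (1 - e^{-y})` where `e^{-y} < u`, and `-1 /
e^{-y}` elsewhere. -/
lemma integrable_quantKernel {μ : Measure ℝ} [IsFiniteMeasure μ] (h : μ (Iic 0) = 0) {u : ℝ}
    (hu : u ∈ Ioo (0 : ℝ) 1) : Integrable (quantKernel u) μ := by
  refine Integrable.of_bound (measurable_uncurry_quantKernel.of_uncurry_left).aestronglyMeasurable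
    (1 / u + 1 / (1 - u)) ?_
  filter_upwards [ae_pos h] with y hy
  have h1 := one_sub_exp_neg_pos hy
  have h2 := Real.exp_pos (-y)
  have hu1 := sub_pos.2 hu.2
  have hu0 := hu.1
  rw [quantKernel, h₀_eq]
  split_ifs with hlt
  · have : 1 / (Real.exp (-y) * (1 - Real.exp (-y))) * (1 - (1 - Real.exp (-y)))
        = 1 / (1 - Real.exp (-y)) := by field_simp; ring
    rw [this, Real.norm_of_nonneg (by positivity)]
    have : 1 / (1 - Real.exp (-y)) ≤ 1 / (1 - u) :=
      one_div_le_one_div_of_le hu1 (by linarith)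
    have : 0 < 1 / u := by positivity
    linarith
  · have : 1 / (Real.exp (-y) * (1 - Real.exp (-y))) * (0 - (1 - Real.exp (-y)))
        = -(1 / Real.exp (-y)) := by field_simp; ring
    rw [this, norm_neg, Real.norm_of_nonneg (by positivity)]
    have : 1 / Real.exp (-y) ≤ 1 / u := one_div_le_one_div_of_le hu0 (not_lt.1 hlt)
    have : 0 < 1 / (1 - u) := by positivity
    linarith

lemma monotoneOn_quant (a : ℝ) {μ : Measure ℝ} [IsFiniteMeasure μ] (h : μ (Iic 0) = 0) :
    MonotoneOn (quant a μ) (Ioo 0 1) := by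
  intro u hu v hv huv
  refine add_le_add_right (integral_mono_ae (integrable_quantKernel h hu)
    (integrable_quantKernel h hv) ?_) a
  filter_upwards [ae_pos h] with y hy
  refine mul_le_mul_of_nonneg_left (sub_le_sub_right ?_ _) (h₀_pos hy).le
  split_ifs <;> first | norm_num; done | grind

lemma iSup_quant (a : ℝ) {μ : Measure ℝ} [IsFiniteMeasure μ] (h : μ (Iic 0) = 0) {k : ℕ}
    (hk : 1 ≤ k) {u : Fin k → ℝ} (hu : ∀ i, u i ∈ Ioo (0 : ℝ) 1) :
    ⨆ i, quant a μ (u i) = quant a μ (⨆ i, u i) := by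
  have : Nonempty (Fin k) := ⟨⟨0, hk⟩⟩
  obtain ⟨j, hj⟩ := exists_eq_ciSup_of_finite (f := u)
  rw [← hj]
  refine le_antisymm (ciSup_le fun i => monotoneOn_quant a h (hu i) (hu j) ?_)
    (le_ciSup (f := fun i => quant a μ (u i)) (finite_range _).bddAbove j)
  rw [hj]
  exact le_ciSup (finite_range u).bddAbove i

variable {Ω : Type*} [MeasurableSpace Ω] {P : Measure Ω} [IsProbabilityMeasure P]
  {μ : Measure ℝ} [IsFiniteMeasure μ]

/-- The mean of the quantile function at a random point with distribution function `t ↦ t ^ k`. -/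
lemma integral_quantKernel (h : μ (Iic 0) = 0) {M : Ω → ℝ} (hM : Measurable M) {k : ℕ}
    (hk : 1 ≤ k) (hMk : ∀ t ∈ Ioo (0 : ℝ) 1, P.real {ω | M ω ≤ t} = t ^ k) :
    Integrable (fun ω => ∫ y, quantKernel (M ω) y ∂μ) P ∧
      ∫ ω, ∫ y, quantKernel (M ω) y ∂μ ∂P = ∫ y in Ioi 0, kernel k y ∂μ := by
  let K : Ω → ℝ → ℝ := fun ω y => quantKernel (M ω) y
  have hK : Measurable (Function.uncurry K) :=
    measurable_uncurry_quantKernel.comp ((hM.comp measurable_fst).prodMk measurable_snd)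
  have hset : ∀ t, MeasurableSet {ω | t < M ω} := fun t => measurableSet_lt measurable_const hM
  have hind : ∀ t, Integrable ({ω | t < M ω}.indicator (1 : Ω → ℝ)) P := fun t =>
    (integrable_indicator_iff (hset t)).2 (integrableOn_const (by simp))
  have hprob : ∀ y : ℝ, 0 < y →
      P.real {ω | Real.exp (-y) < M ω} = 1 - Real.exp (-y) ^ k := by
    intro y hy
    rw [← hMk _ ⟨Real.exp_pos _, exp_neg_lt_one hy⟩,
      ← probReal_compl_eq_one_sub (measurableSet_le hM measurable_const)]
    congr 1
    ext
    simp
  have hKe : ∀ y, (fun ω => K ω y) = fun ω =>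
      h₀ y * ({ω | Real.exp (-y) < M ω}.indicator 1 ω - (1 - Real.exp (-y))) := by
    intro y
    funext ω
    simp [K, quantKernel, indicator]
  have hKint : ∀ y, Integrable (fun ω => K ω y) P := by
    intro y
    rw [hKe]
    exact ((hind _).sub (integrable_const _)).const_mul _
  have hKn : ∀ y : ℝ, 0 < y → (fun ω => ‖K ω y‖) = fun ω =>
      h₀ y * ((2 * Real.exp (-y) - 1) * {ω | Real.exp (-y) < M ω}.indicator 1 ω
        + (1 - Real.exp (-y))) := by
    intro y hy
    have h1 := one_sub_exp_neg_pos hy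
    have h2 := Real.exp_pos (-y)
    funext ω
    simp only [K, quantKernel, indicator, norm_mul, mem_ofPred_eq, Pi.one_apply,
      Real.norm_of_nonneg (h₀_pos hy).le]
    congr 1
    split_ifs
    · rw [Real.norm_of_nonneg (by linarith)]
      ring
    · rw [Real.norm_of_nonpos (by linarith)]
      ring
  have hexp : ∀ (y : ℝ) (j : ℕ), Real.exp (-(j * y)) = Real.exp (-y) ^ j := fun y j => by
    rw [← Real.exp_nat_mul]
    ring_nf
  have hprod : Integrable (Function.uncurry K) (P.prod μ) := by
    rw [integrable_prod_iff' hK.aestronglyMeasurable]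
    refine ⟨ae_of_all _ hKint, ?_⟩
    have hi : ∀ j : ℕ, 1 ≤ j → Integrable (kernel j) μ := fun j hj => by
      have := integrableOn_kernel μ (x := j) (by exact_mod_cast hj)
      rwa [IntegrableOn, restrict_Ioi_eq_self h] at this
    -- With `t = e^{-y}`, the norm has mean `h₀ y * ((2t - 1)(1 - t^k) + 1 - t)`, which equals `2 *
    -- kernel (k + 1) y - kernel k y`.
    refine (((hi (k + 1) (by omega)).const_mul 2).sub (hi k hk)).congr ?_
    filter_upwards [ae_pos h] with y hy
    change _ = ∫ ω, ‖K ω y‖ ∂P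
    rw [hKn y hy, integral_const_mul, integral_add ((hind _).const_mul _) (integrable_const _),
      integral_const_mul, integral_indicator_one (hset _), hprob y hy]
    simp only [kernel, hexp, Pi.sub_apply, integral_const, probReal_univ, one_smul]
    ring
  have hval : ∀ y : ℝ, 0 < y → ∫ ω, K ω y ∂P = kernel k y := by
    intro y hy
    rw [hKe, integral_const_mul, integral_sub (hind _) (integrable_const _),
      integral_indicator_one (hset _), hprob y hy, kernel, hexp]
    simp
  refine ⟨hprod.integral_prod_left, ?_⟩
  rw [restrict_Ioi_eq_self h]
  refine (integral_integral_swap hprod).trans (integral_congr_ae ?_)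
  filter_upwards [ae_pos h] with y hy
  exact hval y hy

end Quantile

/-! ### The reflection `e^{-y} ↔ 1 - e^{-y}`. -/

section Reflection

/-- The involution `y ↦ -log (1 - e^{-y})` of `(0, ∞)`. -/
noncomputable def reflection (y : ℝ) : ℝ := -Real.log (1 - Real.exp (-y))

lemma measurable_reflection : Measurable reflection := by
  unfold reflection
  fun_prop

lemma exp_neg_reflection {y : ℝ} (hy : 0 < y) :
    Real.exp (-reflection y) = 1 - Real.exp (-y) := by
  rw [reflection, neg_neg, Real.exp_log (one_sub_exp_neg_pos hy)]

lemma reflection_pos {y : ℝ} (hy : 0 < y) : 0 < reflection y := by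
  have := Real.log_neg (one_sub_exp_neg_pos hy) (by linarith [Real.exp_pos (-y)])
  rw [reflection]
  linarith

lemma h₀_reflection {y : ℝ} (hy : 0 < y) : h₀ (reflection y) = h₀ y := by
  rw [h₀_eq, h₀_eq, exp_neg_reflection hy]
  ring

lemma reflection_le_iff {y z : ℝ} (hy : 0 < y) (hz : 0 < z) :
    reflection z ≤ y ↔ reflection y ≤ z := by
  rw [← neg_le_neg_iff, ← Real.exp_le_exp, exp_neg_reflection hz,
    ← neg_le_neg_iff (b := reflection y), ← Real.exp_le_exp (x := -z), exp_neg_reflection hy]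
  constructor <;> intro h <;> linarith

/-- A decreasing involution pulls `(0, y]` back to `[reflection y, ∞)`, so the condition is equality
of the two measures on rays. -/
lemma IsReflectionInvariant.map_reflection {μ : Measure ℝ} [IsFiniteMeasure μ]
    (hr : IsReflectionInvariant μ) (h : μ (Iic 0) = 0) : μ.map reflection = μ := by
  refine Measure.ext_of_Iic _ _ fun y => ?_
  rw [Measure.map_apply measurable_reflection measurableSet_Iic]
  rcases le_or_gt y 0 with hy | hy
  · rw [measure_mono_null (Iic_subset_Iic.2 hy) h]
    refine measure_mono_null (fun z hz => ?_) h
    by_contra hz0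
    have := reflection_pos (not_le.1 hz0)
    simp only [mem_preimage, mem_Iic] at hz
    linarith
  · have e1 : μ (Iic y) = μ (Ioc 0 y) := by
      refine measure_congr ?_
      filter_upwards [ae_pos h] with z hz
      exact propext ⟨fun hzy => ⟨hz, hzy⟩, fun hzy => hzy.2⟩
    rw [e1, hr y hy]
    refine measure_congr ?_
    filter_upwards [ae_pos h] with z hz
    exact propext (reflection_le_iff hy hz)

/-- Substituting `reflection` sends the integrand at `1 - u` to minus the integrand at `u`, except
where `e^{-y} = u`; this set is `μ`-null for all but countably many `u`. -/
lemma IsReflectionInvariant.quant_one_sub {μ : Measure ℝ} [IsFiniteMeasure μ]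
    (hr : IsReflectionInvariant μ) (h : μ (Iic 0) = 0) (a : ℝ) :
    ∀ᵐ u : ℝ, quant a μ (1 - u) - a = a - quant a μ u := by
  have hcount : {t : ℝ | 0 < μ {y | Real.exp (-y) = t}}.Countable :=
    Measure.countable_meas_level_set_pos (by fun_prop)
  filter_upwards [hcount.ae_notMem volume] with u hu
  have hne : ∀ᵐ y ∂μ, Real.exp (-y) ≠ u := by
    rw [ae_iff]
    simpa using hu
  have e : ∫ y, quantKernel (1 - u) y ∂μ = -∫ y, quantKernel u y ∂μ := by
    conv_lhs => rw [← hr.map_reflection h]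
    rw [integral_map measurable_reflection.aemeasurable
      (measurable_uncurry_quantKernel.of_uncurry_left).aestronglyMeasurable, ← integral_neg]
    refine integral_congr_ae ?_
    filter_upwards [hne, ae_pos h] with y hy hy0
    rw [quantKernel, quantKernel, h₀_reflection hy0, exp_neg_reflection hy0, ← mul_neg]
    congr 1
    split_ifs <;> grind
  rw [quant, quant, e]
  ring

end Reflection

/-! ### Uniform variables on `(0, 1)`. -/

section Uniform

variable {Ω : Type*} [MeasurableSpace Ω] {P : Measure Ω} {U : Ω → ℝ}

lemma uniform_real_le (hU : MeasurePreserving U P (volume.restrict (Ioo 0 1))) {t : ℝ}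
    (ht : t ∈ Ioo (0 : ℝ) 1) : P.real {ω | U ω ≤ t} = t := by
  have : {ω | U ω ≤ t} = U ⁻¹' Iic t := rfl
  rw [this, measureReal_def, hU.measure_preimage measurableSet_Iic.nullMeasurableSet,
    Measure.restrict_apply measurableSet_Iic]
  have : Iic t ∩ Ioo 0 1 = Ioc 0 t := by
    ext x
    simp only [mem_inter_iff, mem_Iic, mem_Ioo, mem_Ioc]
    have := ht.2
    constructor
    · rintro ⟨h1, h2, h3⟩
      exact ⟨h2, h1⟩
    · rintro ⟨h1, h2⟩
      exact ⟨h2, h1, by linarith⟩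
  rw [this, Real.volume_Ioc, sub_zero, ENNReal.toReal_ofReal ht.1.le]

lemma uniform_ae_mem (hU : MeasurePreserving U P (volume.restrict (Ioo 0 1))) :
    ∀ᵐ ω ∂P, U ω ∈ Ioo (0 : ℝ) 1 :=
  hU.quasiMeasurePreserving.ae (ae_restrict_mem measurableSet_Ioo)

end Uniform

/-! ### From a reflection-invariant measure to a symmetric variable. -/

section Converse

variable {Ω : Type*} [MeasurableSpace Ω] {P : Measure Ω} [IsProbabilityMeasure P] {U : Ω → ℝ}
  {μ : Measure ℝ} [IsFiniteMeasure μ]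

lemma ae_pi_forall {p : Ω → Prop} (hp : ∀ᵐ ω ∂P, p ω) (k : ℕ) :
    ∀ᵐ ω ∂(Measure.pi fun _ : Fin k => P), ∀ i, p (ω i) :=
  ae_all_iff.2 fun i =>
    (measurePreserving_eval (fun _ : Fin k => P) i).quasiMeasurePreserving.ae hp

/-- The maximum passes inside the monotone `quant`, and the maximum of `k` uniform variables has
distribution function `t^k`. -/
lemma expectedMax_quant (hU : MeasurePreserving U P (volume.restrict (Ioo 0 1)))
    (h : μ (Iic 0) = 0) (a : ℝ) {k : ℕ} (hk : 1 ≤ k) :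
    expectedMax P (fun ω => quant a μ (U ω)) k = a + ∫ y in Ioi 0, kernel k y ∂μ := by
  have hq := integral_quantKernel (P := Measure.pi fun _ : Fin k => P) h
    (measurable_iSup_eval hU.measurable k) hk
    fun t ht => by rw [pi_real_iSup_le hk, uniform_real_le hU ht]
  rw [expectedMax, ← hq.2]
  have : ∫ ω, (a + ∫ y, quantKernel (⨆ i, U (ω i)) y ∂μ) ∂(Measure.pi fun _ : Fin k => P)
      = a + ∫ ω, ∫ y, quantKernel (⨆ i, U (ω i)) y ∂μ ∂(Measure.pi fun _ : Fin k => P) := by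
    rw [integral_add (integrable_const a) hq.1]
    simp
  rw [← this]
  refine integral_congr_ae ?_
  filter_upwards [ae_pi_forall (uniform_ae_mem hU) k] with ω hω
  exact iSup_quant a h hk hω

lemma integrable_quant (hU : MeasurePreserving U P (volume.restrict (Ioo 0 1)))
    (h : μ (Iic 0) = 0) (a : ℝ) : Integrable (fun ω => quant a μ (U ω)) P :=
  (integrable_const a).add (integral_quantKernel h hU.measurable le_rfl
    fun t ht => by rw [uniform_real_le hU ht, pow_one]).1

lemma integral_quant (hU : MeasurePreserving U P (volume.restrict (Ioo 0 1)))
    (h : μ (Iic 0) = 0) (a : ℝ) : ∫ ω, quant a μ (U ω) ∂P = a := by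
  have hq := integral_quantKernel (P := P) h hU.measurable le_rfl
    fun t ht => by rw [uniform_real_le hU ht, pow_one]
  simp only [quant]
  rw [integral_add (integrable_const a) hq.1, hq.2]
  simp [kernel_one]

lemma expectedMax_of_ae_eq_const {X : Ω → ℝ} {c : ℝ} (hc : ∀ᵐ ω ∂P, X ω = c) {k : ℕ}
    (hk : 1 ≤ k) : expectedMax P X k = c := by
  have : Nonempty (Fin k) := ⟨⟨0, hk⟩⟩
  have : ∫ _ω : Fin k → Ω, c ∂(Measure.pi fun _ => P) = c := by simp
  rw [expectedMax, ← this]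
  refine integral_congr_ae ?_
  filter_upwards [ae_pi_forall hc k] with ω hω
  simp [hω]

lemma measurePreserving_one_sub :
    MeasurePreserving (fun u : ℝ => 1 - u) (volume.restrict (Ioo 0 1))
      (volume.restrict (Ioo 0 1)) := by
  have := (Measure.measurePreserving_sub_left (volume : Measure ℝ) 1).restrict_preimage
    (measurableSet_Ioo (a := (0 : ℝ)) (b := 1))
  simpa using this

lemma isSymmetricNondegenerate_quant (hU : MeasurePreserving U P (volume.restrict (Ioo 0 1)))
    (h : μ (Iic 0) = 0) (hμ : μ ≠ 0) (hr : IsReflectionInvariant μ) (a : ℝ) :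
    IsSymmetricNondegenerate P fun ω => quant a μ (U ω) where
  measurable := (measurable_quant a μ).comp hU.measurable
  integrable := integrable_quant hU h a
  nondegenerate := by
    rintro ⟨c, hc⟩
    -- A constant would have equal first and second expected maxima, but here they differ by `∫
    -- kernel 2 dμ`, the total mass of `μ`.
    have e := (expectedMax_of_ae_eq_const hc one_le_two).trans
      (expectedMax_of_ae_eq_const hc le_rfl).symm
    rw [expectedMax_quant hU h a one_le_two, expectedMax_quant hU h a le_rfl] at e
    have e2 : ∫ y in Ioi 0, kernel (2 : ℕ) y ∂μ = μ.real univ := by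
      rw [Nat.cast_ofNat]
      rw [setIntegral_congr_fun measurableSet_Ioi
        (fun y hy => kernel_two hy : EqOn (kernel 2) (fun _ => 1) (Ioi 0)), restrict_Ioi_eq_self h]
      simp
    simp only [e2, Nat.cast_one, kernel_one, integral_zero, add_right_inj] at e
    exact hμ (Measure.measure_univ_eq_zero.1 ((measureReal_eq_zero_iff).1 e))
  symmetric := by
    have hm := measurable_quant a μ
    rw [integral_quant hU h a]
    refine ⟨((hm.comp hU.measurable).sub_const a).aemeasurable,
      ((hm.comp hU.measurable).const_sub a).aemeasurable, ?_⟩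
    have e1 : P.map (fun ω => quant a μ (U ω) - a)
        = (volume.restrict (Ioo 0 1)).map fun u => quant a μ u - a := by
      rw [← hU.map_eq, Measure.map_map (hm.sub_const a) hU.measurable]
      rfl
    have e2 : P.map (fun ω => a - quant a μ (U ω))
        = (volume.restrict (Ioo 0 1)).map fun u => a - quant a μ u := by
      rw [← hU.map_eq, Measure.map_map (hm.const_sub a) hU.measurable]
      rfl
    rw [e1, e2]
    -- `U` and `1 - U` have the same law.
    conv_lhs => rw [← measurePreserving_one_sub.map_eq]
    rw [Measure.map_map (hm.sub_const a) (by fun_prop)]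
    exact Measure.map_congr (ae_restrict_of_ae (hr.quant_one_sub h a))

universe u

/-- `ULift` places the sample space in an arbitrary universe, as the existential in the theorem
demands. -/
lemma exists_uniform : ∃ (Ω : Type u) (_ : MeasurableSpace Ω) (P : Measure Ω) (U : Ω → ℝ),
    IsProbabilityMeasure P ∧ MeasurePreserving U P (volume.restrict (Ioo 0 1)) := by
  have : IsProbabilityMeasure ((volume : Measure ℝ).restrict (Ioo 0 1)) := ⟨by simp⟩
  refine ⟨ULift.{u} ℝ, inferInstance, (volume.restrict (Ioo 0 1)).map ULift.up, ULift.down,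
    Measure.isProbabilityMeasure_map measurable_up.aemeasurable, measurable_down, ?_⟩
  rw [Measure.map_map measurable_down measurable_up]
  exact Measure.map_id

lemma exists_isEMSOf_of_isReflectionInvariant {g : Ici (1 : ℝ) → ℝ} (hg : g ∈ classGStar)
    {m : ℕ → ℝ} (hgm : Extends g m) {μ : Measure ℝ} (H : IsCanonicalMeasure g μ)
    (hr : IsReflectionInvariant μ) :
    ∃ (Ω : Type u) (_ : MeasurableSpace Ω) (P : Measure Ω) (X : Ω → ℝ),
      IsProbabilityMeasure P ∧ IsSymmetricNondegenerate P X ∧ IsEMSOf P X m := by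
  have := H.isFiniteMeasure
  have hμ : μ ≠ 0 := by
    rintro rfl
    exact hg.2 ⟨_, fun x => by simpa using H.apply_eq x⟩
  obtain ⟨Ω, _, P, U, hP, hU⟩ := exists_uniform.{u}
  exact ⟨Ω, _, P, fun ω => quant (m 1) μ (U ω), hP,
    isSymmetricNondegenerate_quant hU H.concentrated hμ hr _,
    fun k hk => by rw [expectedMax_quant hU H.concentrated _ hk, ← H.extends_eq hgm hk]⟩

end Converse

end EMS


theorem theorem4p3 (m : ℕ → ℝ) :
    -- every function in the class has exactly one canonical measure
    (∀ g ∈ EMS.classGStar, ∃! μ : MeasureTheory.Measure ℝ, EMS.IsCanonicalMeasure g μ) ∧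
    -- the characterization
    ((∃ (Ω : Type*) (_ : MeasurableSpace Ω) (P : MeasureTheory.Measure Ω) (X : Ω → ℝ),
        MeasureTheory.IsProbabilityMeasure P ∧ EMS.IsSymmetricNondegenerate P X ∧
          EMS.IsEMSOf P X m) ↔
      ∃ g ∈ EMS.classGStar, EMS.Extends g m ∧
        ∃ μ : MeasureTheory.Measure ℝ,
          EMS.IsCanonicalMeasure g μ ∧ EMS.IsReflectionInvariant μ) ∧
    -- uniqueness of the extension
    (∀ g₁ ∈ EMS.classGStar, ∀ g₂ ∈ EMS.classGStar,
      EMS.Extends g₁ m → EMS.Extends g₂ m → g₁ = g₂) ∧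
    -- the explicit form of the extension
    (∀ (Ω : Type*) (_ : MeasurableSpace Ω) (P : MeasureTheory.Measure Ω) (X : Ω → ℝ),
      MeasureTheory.IsProbabilityMeasure P → EMS.IsSymmetricNondegenerate P X →
      EMS.IsEMSOf P X m →
      0 < m 2 - m 1 ∧
      MeasureTheory.IsProbabilityMeasure (EMS.lawV P X (m 2 - m 1)) ∧
      EMS.lawY P X (m 2 - m 1) (Set.Iic 0) = 0 ∧
      ∀ g ∈ EMS.classGStar, EMS.Extends g m →
        ∀ x : Set.Ici (1 : ℝ),
          MeasureTheory.IntegrableOn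
            (fun y : ℝ => (m 2 - m 1) * Real.exp y / (1 - Real.exp (-y)) *
              (m 1 / (m 2 - m 1) * Real.exp (-y) * (1 - Real.exp (-y))
                + Real.exp (-y) - Real.exp (-((x : ℝ) * y))))
            (Set.Ioi 0) (EMS.lawY P X (m 2 - m 1)) ∧
          g x = ∫ y in Set.Ioi 0, (m 2 - m 1) * Real.exp y / (1 - Real.exp (-y)) *
              (m 1 / (m 2 - m 1) * Real.exp (-y) * (1 - Real.exp (-y))
                + Real.exp (-y) - Real.exp (-((x : ℝ) * y)))
            ∂(EMS.lawY P X (m 2 - m 1))) := by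
  refine ⟨fun g hg => EMS.existsUnique_isCanonicalMeasure hg, ⟨?_, ?_⟩,
    fun g₁ h₁ g₂ h₂ => EMS.eq_of_extends h₁ h₂, ?_⟩
  · rintro ⟨Ω, _, P, X, hP, hs, hm⟩
    obtain ⟨g, hg, hgm, H⟩ := hm.exists_extension hs
    exact ⟨g, hg, hgm, _, ⟨_, H⟩, (hs.isReflectionInvariant_lawY _).smul _⟩
  · rintro ⟨g, hg, hgm, μ, H, hr⟩
    exact EMS.exists_isEMSOf_of_isReflectionInvariant hg hgm H hr
  · intro Ω _ P X hP hs hm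
    exact ⟨hm.sub_pos hs, hm.isProbabilityMeasure_lawV hs, EMS.lawY_Iic_zero,
      fun g hg hgm => hm.explicit_form hs hg hgm⟩
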